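/- Let $G$ be a connected (finite-dimensional, real) Lie group with Lie algebra $\mathfrak g$, let $\omega$ be a symplectic form on $\mathfrak g$ (a nondegenerate alternating bilinear form with $\omega([u,v],w)+\omega([v,w],u)+\omega([w,u],v)=0$ for all $u,v,w$), and for $u\in\mathfrak g$ let $\mathrm{ad}_u^*$ be the adjoint of $\mathrm{ad}_u$ with respect to $\omega$, i.e. $\omega(\mathrm{ad}_u^*v,w)=\omega(v,[u,w])$. Suppose that $(\mathfrak g,\omega)$ is a non-abelian symplectic Poisson algebra, i.e. $\mathfrak g$ is not abelian, is 2-nilpotent ($[[u,v],w]=0$ for all $u,v,w$), and $[\mathrm{ad}_u,\mathrm{ad}_v^*]=0$ for all $u,v\in\mathfrak g$. Let $\Omega$ be the left-invariant 2-form on $G$ with value $\omega$ at the identity, and let $\nabla^{\mathrm a}$ be the left-invariant linear connection on $G$ given by $$\Omega(\nabla^{\mathrm a}_{u^+}v^+,w^+)=-\Omega(v^+,[u^+,w^+]),\qquad u,v,w\in\mathfrak g,$$ where $u^+$ denotes the left-invariant vector field with value $u$ at the identity. Then: 1. $(\nabla^{\mathrm a})^3\Omega=0$. 2. Let $(x_1,\dots,x_n)$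 be an affine coordinate chart of $\nabla^{\mathrm a}$ (a smooth chart with $\nabla^{\mathrm a}_{\partial_i}\partial_j=0$ for all $i,j$) whose domain is non-empty and connected. Then $\Omega$ is polynomial of degree at least $1$ and at most $2$ in this chart: the components $\Omega(\partial_i,\partial_j)$ are polynomials in $x_1,\dots,x_n$, and the largest of their total degrees is $1$ or $2$. 3. If moreover the restriction of $\omega$ to $[\mathfrak g,\mathfrak g]$ does not vanish, then the degree in 2 is exactly $2$. -/

import Mathlib

section SymplecticPoisson

variable {K L : Type*} [Field K] [LieRing L] [LieAlgebra K L]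

/-- A symplectic form on a Lie algebra: an alternating nondegenerate bilinear form which is closed,
i.e. a 2-cocycle for the trivial module. -/
structure IsSymplecticForm (σ : LinearMap.BilinForm K L) : Prop where
  alt : σ.IsAlt
  nondegenerate : σ.Nondegenerate
  closed : ∀ u v w : L, σ ⁅u, v⁆ w + σ ⁅v, w⁆ u + σ ⁅w, u⁆ v = 0

variable [FiniteDimensional K L]

/-- The adjoint of `ad u` with respect to `σ`: `σ (adAdjoint σ hσ u v) w = σ v ⁅u, w⁆`. -/
noncomputable def adAdjoint (σ : LinearMap.BilinForm K L) (hσ : σ.Nondegenerate) (u : L) :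
    Module.End K L :=
  σ.leftAdjointOfNondegenerate hσ (LieAlgebra.ad K L u)

theorem adAdjoint_spec (σ : LinearMap.BilinForm K L) (hσ : σ.Nondegenerate) (u v w : L) :
    σ (adAdjoint σ hσ u v) w = σ v ⁅u, w⁆ :=
  σ.isAdjointPairLeftAdjointOfNondegenerate hσ (LieAlgebra.ad K L u) v w

/-- A symplectic Poisson algebra: a symplectic Lie algebra which is 2-nilpotent and satisfies
`[ad u, (ad v)^*] = 0` for all `u`, `v`, the adjoint being taken with respect to the symplectic
form. -/
structure IsSymplecticPoissonAlgebra (σ : LinearMap.BilinForm K L) : Prop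
    extends IsSymplecticForm σ where
  two_nilpotent : ∀ u v w : L, ⁅⁅u, v⁆, w⁆ = 0
  ad_comm : ∀ u v : L,
    LieAlgebra.ad K L u * adAdjoint σ nondegenerate v =
      adAdjoint σ nondegenerate v * LieAlgebra.ad K L u

/-- The product `(u, v) ↦ -(ad u)^* v`. -/
noncomputable def leftSymmetricProduct (σ : LinearMap.BilinForm K L) (hσ : σ.Nondegenerate) :
    L →ₗ[K] L →ₗ[K] L :=
  LinearMap.mk₂ K (fun u v => -adAdjoint σ hσ u v)
    (fun u u' v => by
      rw [← sub_eq_zero]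
      refine hσ.1 _ fun w => ?_
      simp only [map_sub, map_neg, map_add, LinearMap.sub_apply, LinearMap.neg_apply,
        LinearMap.add_apply, adAdjoint_spec, add_lie]
      ring)
    (fun c u v => by
      rw [← sub_eq_zero]
      refine hσ.1 _ fun w => ?_
      simp only [map_sub, map_neg, map_smul, LinearMap.sub_apply, LinearMap.neg_apply,
        LinearMap.smul_apply, adAdjoint_spec, smul_lie, smul_eq_mul]
      ring)
    (fun u v v' => by rw [map_add, neg_add])
    (fun c u v => by rw [map_smul, smul_neg])

end SymplecticPoisson

open Bundle
open scoped Manifold ContDiff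

noncomputable section

section Tensors

variable {E : Type*} [NormedAddCommGroup E] [NormedSpace ℝ E]
  {H : Type*} [TopologicalSpace H] {I : ModelWithCorners ℝ E H}
  {M : Type*} [TopologicalSpace M] [ChartedSpace H M] [IsManifold I 1 M]

/-- The covariant derivative of a tensor field of type `(0, k)`, tensor fields being viewed as
multilinear operations on vector fields:
`(∇T)(X₀, X₁, …, X_k) = X₀ (T(X₁, …, X_k)) - ∑ i, T(X₁, …, ∇_{X₀} X_i, …, X_k)`.
It is meant to be evaluated on smooth vector fields. -/
def covTensorDeriv (cov : CovariantDerivative I E (TangentSpace I : M → Type _)) {k : ℕ}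
    (T : (Fin k → Π x : M, TangentSpace I x) → M → ℝ) :
    (Fin (k + 1) → Π x : M, TangentSpace I x) → M → ℝ :=
  fun X x => mvfderiv I (T (Fin.tail X)) x (X 0 x) -
    ∑ i : Fin k, T (Function.update (Fin.tail X) i (fun y => cov (Fin.tail X i) y (X 0 y))) x

/-- The iterated covariant derivative `∇^m T`. -/
def iteratedCovTensorDeriv (cov : CovariantDerivative I E (TangentSpace I : M → Type _)) {k : ℕ}
    (T : (Fin k → Π x : M, TangentSpace I x) → M → ℝ) :
    (m : ℕ) → (Fin (k + m) → Π x : M, TangentSpace I x) → M → ℝ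
  | 0 => T
  | m + 1 => covTensorDeriv cov (iteratedCovTensorDeriv cov T m)

/-- A field of bilinear forms, viewed as an operation on pairs of vector fields. -/
def bilinTensor (Ω : Π x : M, LinearMap.BilinForm ℝ (TangentSpace I x)) :
    (Fin 2 → Π x : M, TangentSpace I x) → M → ℝ :=
  fun X x => Ω x (X 0 x) (X 1 x)

end Tensors

section AffineCharts

variable {E : Type*} [NormedAddCommGroup E] [NormedSpace ℝ E]
  {M : Type*} [TopologicalSpace M] [ChartedSpace E M]

/-- The coordinate vector field of the chart `φ` in the direction `e`: on the domain of `φ` it is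
the vector field which `dφ` sends to the constant vector `e`. -/
def coordField (φ : OpenPartialHomeomorph M E) (e : E) : Π x : M, TangentSpace 𝓘(ℝ, E) x :=
  VectorField.mpullback 𝓘(ℝ, E) 𝓘(ℝ, E) φ (fun _ => e)

/-- An affine coordinate chart for the connection `cov`: a smooth chart whose coordinate vector
fields are parallel on the domain of the chart. -/
structure IsAffineChart [IsManifold 𝓘(ℝ, E) 1 M]
    (cov : CovariantDerivative 𝓘(ℝ, E) E (TangentSpace 𝓘(ℝ, E) : M → Type _))
    (φ : OpenPartialHomeomorph M E) : Prop where
  mem_maximalAtlas : φ ∈ IsManifold.maximalAtlas 𝓘(ℝ, E) ∞ M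
  parallel : ∀ e : E, ∀ x ∈ φ.source, cov (coordField φ e) x = 0

/-- In the coordinates of the chart `φ`, the components `Ω(∂ᵢ, ∂ⱼ)` are polynomial functions of the
coordinates, and the largest total degree of these polynomials is `d`. -/
def IsPolynomialOfDegreeIn {n : ℕ} {M : Type*} [TopologicalSpace M]
    [ChartedSpace (EuclideanSpace ℝ (Fin n)) M]
    (Ω : Π x : M, LinearMap.BilinForm ℝ (TangentSpace (𝓡 n) x))
    (φ : OpenPartialHomeomorph M (EuclideanSpace ℝ (Fin n))) (d : ℕ) : Prop :=
  ∃ P : Fin n → Fin n → MvPolynomial (Fin n) ℝ,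
    (∀ i j, ∀ x ∈ φ.source,
      Ω x (coordField φ (EuclideanSpace.single i 1) x) (coordField φ (EuclideanSpace.single j 1) x)
        = MvPolynomial.eval (fun k => φ x k) (P i j)) ∧
    (Finset.univ.sup fun p : Fin n × Fin n => (P p.1 p.2).totalDegree) = d

end AffineCharts

section LieGroups

instance LieGroup.instMinSmoothnessThree {E : Type*} [NormedAddCommGroup E] [NormedSpace ℝ E]
    {H : Type*} [TopologicalSpace H] {I : ModelWithCorners ℝ E H}
    {G : Type*} [TopologicalSpace G] [ChartedSpace H G] [Group G] [LieGroup I ∞ G] :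
    LieGroup I (minSmoothness ℝ 3) G := by
  rw [minSmoothness_of_isRCLikeNormedField]; infer_instance

variable {E : Type*} [NormedAddCommGroup E] [NormedSpace ℝ E]
  {H : Type*} [TopologicalSpace H] {I : ModelWithCorners ℝ E H}

instance TangentSpace.instFiniteDimensional [FiniteDimensional ℝ E] {M : Type*}
    [TopologicalSpace M] [ChartedSpace H M] (x : M) : FiniteDimensional ℝ (TangentSpace I x) :=
  inferInstanceAs (FiniteDimensional ℝ E)

instance TangentSpace.instT2Space {M : Type*} [TopologicalSpace M] [ChartedSpace H M] (x : M) :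
    T2Space (TangentSpace I x) :=
  inferInstanceAs (T2Space E)

variable {G : Type*} [TopologicalSpace G] [ChartedSpace H G] [Group G]

variable (I) in
/-- The differential at the identity of the left translation by `g`. -/
def leftTranslate (g : G) : GroupLieAlgebra I G →L[ℝ] TangentSpace I g :=
  mfderiv I I (g * ·) 1

variable (I) in
/-- The inverse of the differential at the identity of the left translation by `g`. -/
def leftTrivialize (g : G) : TangentSpace I g →L[ℝ] GroupLieAlgebra I G :=
  (leftTranslate I g).inverse

/-- A vector field read in the left-invariant trivialization of the tangent bundle, as a function
with values in the model space `E` of `T_1 G`. -/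
def leftComponent (Y : Π g : G, TangentSpace I g) : G → E := fun g => leftTrivialize I g (Y g)

/-- The left-invariant field of bilinear forms on `G` with value `σ` at the identity. -/
def leftInvariantForm (σ : LinearMap.BilinForm ℝ (GroupLieAlgebra I G)) (g : G) :
    LinearMap.BilinForm ℝ (TangentSpace I g) :=
  σ.compl₁₂ (leftTrivialize I g).toLinearMap (leftTrivialize I g).toLinearMap

variable [LieGroup I ∞ G]

lemma leftTrivialize_eq (g : G) (v : TangentSpace I g) :
    leftTrivialize I g v = (mfderiv I I (fun b => g⁻¹ * b) g : E → E) v := by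
  have h := inverse_mfderiv_mul_left (I := I) (g := g) (h := 1)
  rw [mul_one] at h
  exact DFunLike.congr_fun h v

lemma mfderiv_mul_left_comp (g h : G) (v : E) :
    (mfderiv I I (fun b => g⁻¹ * b) (g * h) : E → E) ((mfderiv I I (fun b => g * b) h : E → E) v) = v := by
  have M : (∞ : ℕ∞ω) ≠ 0 := by simp
  have A : mfderiv I I ((fun x ↦ g⁻¹ * x) ∘ (fun x ↦ g * x)) h =
      ContinuousLinearMap.id _ _ := by
    have : (fun x ↦ g⁻¹ * x) ∘ (fun x ↦ g * x) = id := by ext x; simp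
    rw [this, id_eq, mfderiv_id]
  rw [mfderiv_comp (I' := I) _ (contMDiff_mul_left.contMDiffAt.mdifferentiableAt M)
    (contMDiff_mul_left.contMDiffAt.mdifferentiableAt M)] at A
  exact DFunLike.congr_fun A v

lemma leftTranslate_isInvertible (g : G) : (leftTranslate I g).IsInvertible := by
  refine ContinuousLinearMap.IsInvertible.of_inverse
     (g := (mfderiv I I (fun b => g⁻¹ * b) g : E →L[ℝ] E)) ?_ ?_
  · ext v
    have := mfderiv_mul_left_comp (I := I) g⁻¹ g v
    rw [inv_inv, inv_mul_cancel] at this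
    exact this
  · ext v
    have := mfderiv_mul_left_comp (I := I) g 1 v
    rw [mul_one] at this
    exact this

lemma leftTrivialize_leftTranslate (g : G) (v : GroupLieAlgebra I G) :
    leftTrivialize I g (leftTranslate I g v) = v := 
  (leftTranslate_isInvertible g).inverse_apply_self v

lemma leftTranslate_leftTrivialize (g : G) (v : TangentSpace I g) :
    leftTranslate I g (leftTrivialize I g v) = v := 
  (leftTranslate_isInvertible g).self_apply_inverse v

lemma mdifferentiableAt_leftComponent {Y : Π g : G, TangentSpace I g} {g : G}
    (hY : MDiffAt (T% Y) g) :
    MDifferentiableAt I 𝓘(ℝ, E) (leftComponent Y) g := by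
  have hn : (∞ : ℕ∞ω) ≠ 0 := by simp
  let F₀ : G → TangentBundle I G := fun h ↦ TotalSpace.mk' E h⁻¹ 0
  have s₀ : MDifferentiableAt I I.tangent F₀ g := by
    have h1 : ContMDiff I I.tangent ∞ (fun g : G ↦ (TotalSpace.mk' E g 0 : TangentBundle I G)) := 
      contMDiff_zeroSection _ _
    exact ((h1.comp (contMDiff_inv I ∞)).contMDiffAt (x := g)).mdifferentiableAt hn
  let F₁ : G → (TangentBundle I G × TangentBundle I G) := fun h ↦ (F₀ h, TotalSpace.mk' E h (Y h))
  have S₁ : MDifferentiableAt I (I.tangent.prod I.tangent) F₁ g := s₀.prodMk hY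
  let F₂ : (TangentBundle I G × TangentBundle I G) → TangentBundle (I.prod I) (G × G) :=
    (equivTangentBundleProd I G I G).symm
  have S₂ : ContMDiff (I.tangent.prod I.tangent) (I.prod I).tangent ∞ F₂ := contMDiff_equivTangentBundleProd_symm
  let F₃ : TangentBundle (I.prod I) (G × G) → TangentBundle I G :=
    tangentMap (I.prod I) I (fun (p : G × G) ↦ p.1 * p.2)
  have S₃ : ContMDiff (I.prod I).tangent I.tangent ∞ F₃ := by
    apply ContMDiff.contMDiff_tangentMap (n := ∞) _ (m := ∞) (by simp)
    exact contMDiff_mul I ∞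
  have S : MDifferentiableAt I I.tangent (F₃ ∘ F₂ ∘ F₁) g :=
    ((S₃.contMDiffAt.mdifferentiableAt hn).comp (I' := (I.prod I).tangent) _ 
      ((S₂.contMDiffAt.mdifferentiableAt hn).comp (I' := I.tangent.prod I.tangent) _ S₁))
  have key : F₃ ∘ F₂ ∘ F₁ = fun h => TotalSpace.mk' E (1 : G) (leftTrivialize I h (Y h)) := by
    funext h
    refine TotalSpace.ext (by simp [F₃, F₂, F₁, F₀]) ?_
    simp [F₃, F₂, F₁, F₀, tangentMap]
    have e := mfderiv_prod_eq_add_apply (I := I) (I' := I) (I'' := I) (f := fun p : G × G => p.1 * p.2)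
      (p := (h⁻¹, h)) (v := ((0 : E), (Y h : E)))
      (((contMDiff_mul I ∞).contMDiffAt (x := (h⁻¹, h))).mdifferentiableAt hn)
    rw [leftTrivialize_eq]
    refine heq_of_eq (e.trans ?_)
    have e0 : mfderiv I I (fun z : G => z * h) h⁻¹ (0 : E) = 0 := map_zero _
    change (mfderiv I I (fun z : G => z * h) h⁻¹ (0 : E) : E) + _ = _
    erw [e0]
    exact zero_add _
  rw [key] at S
  have := ((mdifferentiableAt_totalSpace _ _).1 S).2
  refine this.congr_of_eventuallyEq (Filter.Eventually.of_forall fun h => ?_)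
  exact ((tangentBundleCore I G).coordChange_self (achart H (1 : G)) 1 (mem_achart_source H (1 : G))
    (leftTrivialize I h (Y h))).symm



/-- The derivative at `g` of the vector field `Y` read in the left-invariant trivialization. -/
def leftDeriv (Y : Π g : G, TangentSpace I g) (g : G) : TangentSpace I g →L[ℝ] GroupLieAlgebra I G :=
  mvfderiv I (leftComponent Y) g

lemma leftDeriv_add {Y Z : Π g : G, TangentSpace I g} {g : G} (hY : MDiffAt (T% Y) g) (hZ : MDiffAt (T% Z) g) :
    leftDeriv (Y + Z) g = leftDeriv Y g + leftDeriv Z g := by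
  have h : leftComponent (Y + Z) = leftComponent Y + leftComponent Z := by
    funext h; exact map_add (leftTrivialize I h) (Y h) (Z h)
  unfold leftDeriv
  rw [h]
  exact mvfderiv_add (mdifferentiableAt_leftComponent hY) (mdifferentiableAt_leftComponent hZ)

lemma leftDeriv_smul {Y : Π g : G, TangentSpace I g} {f : G → ℝ} {g : G} (hY : MDiffAt (T% Y) g) 
    (hf : MDifferentiableAt I 𝓘(ℝ, ℝ) f g) :
    leftDeriv (f • Y) g = f g • leftDeriv Y g + (mvfderiv I f g).smulRight (leftTrivialize I g (Y g)) := by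
  have h : leftComponent (f • Y) = f • leftComponent Y := by
    funext h; exact map_smul (leftTrivialize I h) (f h) (Y h)
  unfold leftDeriv
  rw [h]
  exact mvfderiv_smul hf (mdifferentiableAt_leftComponent hY)

lemma leftDeriv_mulInvariantVectorField (v : GroupLieAlgebra I G) (g : G) :
    leftDeriv (mulInvariantVectorField v) g = 0 := by
  have h : leftComponent (mulInvariantVectorField v : Π g : G, TangentSpace I g) = fun _ => v := by
    funext h
    exact leftTrivialize_leftTranslate h v
  unfold leftDeriv
  rw [h]
  exact mvfderiv_const _

variable [FiniteDimensional ℝ E]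

/-- The left-invariant connection with `∇_{u⁺} v⁺ = (α u v)⁺`, where `u⁺` is the left-invariant vector
field with value `u` at the identity. -/
def leftInvariantConnection
    (α : GroupLieAlgebra I G →ₗ[ℝ] GroupLieAlgebra I G →ₗ[ℝ] GroupLieAlgebra I G) :
    CovariantDerivative I E (TangentSpace I : G → Type _) where
  toFun Y g := leftTranslate I g ∘L (leftDeriv Y g +
    (α.flip (leftTrivialize I g (Y g))).toContinuousLinearMap ∘L leftTrivialize I g)
  isCovariantDerivativeOnUniv :=
    { add := by
        intro Y Z g hY hZ _
        ext X
        simp only [leftDeriv_add hY hZ, Pi.add_apply, map_add, ContinuousLinearMap.comp_apply,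
          add_apply, LinearMap.coe_toContinuousLinearMap']
        simp only [LinearMap.flip_apply]
        abel
      leibniz := by
        intro Y f g hY hf _
        ext X
        simp only [leftDeriv_smul hY hf, ContinuousLinearMap.comp_apply, add_apply,
          LinearMap.coe_toContinuousLinearMap', LinearMap.flip_apply, map_add, Pi.smul_apply',
          map_smul, smul_apply, ContinuousLinearMap.smulRight_apply,
          leftTranslate_leftTrivialize, smul_add]
        abel }

theorem leftInvariantConnection_apply
    (α : GroupLieAlgebra I G →ₗ[ℝ] GroupLieAlgebra I G →ₗ[ℝ] GroupLieAlgebra I G)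
    (u v : GroupLieAlgebra I G) (g : G) :
    leftInvariantConnection α (mulInvariantVectorField v) g (mulInvariantVectorField u g) =
      mulInvariantVectorField (α u v) g := by
  change leftTranslate I g (leftDeriv (mulInvariantVectorField v) g _ +
    α (leftTrivialize I g (leftTranslate I g u)) (leftTrivialize I g (leftTranslate I g v))) =
      leftTranslate I g (α u v)
  rw [leftDeriv_mulInvariantVectorField, leftTrivialize_leftTranslate,
    leftTrivialize_leftTranslate]
  simp

/-- The left-invariant connection `∇^a` of a symplectic Lie group; its defining formula is
`symplecticAffineConnection_spec`. -/
def symplecticAffineConnection (σ : LinearMap.BilinForm ℝ (GroupLieAlgebra I G))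
    (hσ : σ.Nondegenerate) : CovariantDerivative I E (TangentSpace I : G → Type _) :=
  leftInvariantConnection (leftSymmetricProduct σ hσ)

/-- `Ω(∇^a_{u⁺} v⁺, w⁺) = -Ω(v⁺, [u⁺, w⁺])`, where `Ω` is the left-invariant form defined by `σ`. -/
theorem symplecticAffineConnection_spec (σ : LinearMap.BilinForm ℝ (GroupLieAlgebra I G))
    (hσ : σ.Nondegenerate) (u v w : GroupLieAlgebra I G) (g : G) :
    leftInvariantForm σ g
        (symplecticAffineConnection σ hσ (mulInvariantVectorField v) g
          (mulInvariantVectorField u g))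
        (mulInvariantVectorField w g) =
      -leftInvariantForm σ g (mulInvariantVectorField v g)
        (VectorField.mlieBracket I (mulInvariantVectorField u) (mulInvariantVectorField w) g) := by
  have : CompleteSpace E := FiniteDimensional.complete ℝ E
  rw [symplecticAffineConnection, leftInvariantConnection_apply, ← mulInvariantVector_mlieBracket,
    ← GroupLieAlgebra.bracket_def]
  change σ (leftTrivialize I g (leftTranslate I g _)) (leftTrivialize I g (leftTranslate I g _)) =
    -σ (leftTrivialize I g (leftTranslate I g _)) (leftTrivialize I g (leftTranslate I g _))
  simp only [leftTrivialize_leftTranslate]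
  change σ (-adAdjoint σ hσ u v) w = _
  rw [map_neg, LinearMap.neg_apply, adAdjoint_spec]

end LieGroups

end

/-! Write u · v = -(ad u)^* v and T(u, v, w) = σ u ⁅v, w⁆. In the left trivialization Ω has constant
coefficients, so ∇Ω comes from the product alone, and closedness of σ identifies it with T
(`IsSymplecticForm.apply_leftSymmetricProduct_add`). The decisive algebraic fact is that σ vanishes
on the derived algebra (`apply_lie_lie`). Together with 2-nilpotency and the commutation of ad with
its adjoints it makes T parallel (`apply_leftSymmetricProduct_lie_add`), so ∇²Ω = 0 already and the
third derivative vanishes a fortiori.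

In an affine chart the coordinate fields are parallel. The partial derivatives of the components of
Ω are therefore components of T, which are constant on a connected domain, and the components of Ω
are affine functions (`exists_affine_leftInvariantForm`). If all their linear parts were zero, T
would vanish, and nondegeneracy would make the algebra abelian.

The degree is thus always exactly 1. Degree 2 never occurs, and the last claim holds vacuously: its
hypothesis contradicts the isotropy of the derived algebra. -/

/-! ### Algebra: isotropy of the derived algebra and the derivatives of σ. -/

namespace IsSymplecticPoissonAlgebra

variable {K L : Type*} [Field K] [LieRing L] [LieAlgebra K L] [FiniteDimensional K L]
  {σ : LinearMap.BilinForm K L}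

theorem lie_adAdjoint (hσ : IsSymplecticPoissonAlgebra σ) (u v w : L) :
    ⁅u, adAdjoint σ hσ.nondegenerate v w⁆ = adAdjoint σ hσ.nondegenerate v ⁅u, w⁆ :=
  LinearMap.congr_fun (hσ.ad_comm u v) w

/-- This is the cocycle identity for `u`, `(ad w)^* v`, `x`. Commutation pulls the adjoint out of
the first two brackets, so that it moves across σ as a bracket with `w`; the third term contains a
double bracket and vanishes. -/
theorem apply_lie_lie_swap (hσ : IsSymplecticPoissonAlgebra σ) (u v w x : L) :
    σ ⁅u, v⁆ ⁅w, x⁆ = σ ⁅x, v⁆ ⁅w, u⁆ := by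
  have h := hσ.closed u (adAdjoint σ hσ.nondegenerate w v) x
  have h₁ : ⁅adAdjoint σ hσ.nondegenerate w v, x⁆ = -adAdjoint σ hσ.nondegenerate w ⁅x, v⁆ := by
    rw [← lie_skew, hσ.lie_adAdjoint]
  have h₂ : σ ⁅x, u⁆ (adAdjoint σ hσ.nondegenerate w v) = 0 := by
    rw [← hσ.alt.neg_eq, adAdjoint_spec, ← lie_skew, hσ.two_nilpotent]
    simp
  rw [h₁, h₂, hσ.lie_adAdjoint, adAdjoint_spec, map_neg, LinearMap.neg_apply,
    adAdjoint_spec] at h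
  linear_combination h

/-- The derived algebra of a symplectic Poisson algebra is isotropic: on quadruples `(u, v, w, x)`
the transpositions of the first two and of the first and last entries act on `σ ⁅u, v⁆ ⁅w, x⁆`
by opposite signs, although they are conjugate. -/
theorem apply_lie_lie [NeZero (2 : K)] (hσ : IsSymplecticPoissonAlgebra σ) (u v w x : L) :
    σ ⁅u, v⁆ ⁅w, x⁆ = 0 := by
  have swap := hσ.apply_lie_lie_swap
  have skew : ∀ u v w x : L, σ ⁅u, v⁆ ⁅w, x⁆ = -σ ⁅v, u⁆ ⁅w, x⁆ := fun u v w x => by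
    rw [← lie_skew, map_neg, LinearMap.neg_apply]
  -- The two transpositions share an entry, so their composite is a 3-cycle: three rounds restore
  -- the entries and leave the sign (-1)³.
  have h : σ ⁅u, v⁆ ⁅w, x⁆ = -σ ⁅u, v⁆ ⁅w, x⁆ := by
    conv_lhs => rw [swap, skew, swap, skew, swap, skew]
    simp
  have h' : (2 : K) * σ ⁅u, v⁆ ⁅w, x⁆ = 0 := by linear_combination h
  exact (mul_eq_zero.1 h').resolve_left two_ne_zero

theorem apply_eq_zero_of_mem_derived [NeZero (2 : K)] (hσ : IsSymplecticPoissonAlgebra σ) {x y : L}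
    (hx : x ∈ (⁅(⊤ : LieIdeal K L), (⊤ : LieIdeal K L)⁆ : LieIdeal K L))
    (hy : y ∈ (⁅(⊤ : LieIdeal K L), (⊤ : LieIdeal K L)⁆ : LieIdeal K L)) : σ x y = 0 := by
  rw [← LieSubmodule.mem_toSubmodule, LieSubmodule.lieIdeal_oper_eq_linear_span'] at hx hy
  induction hx using Submodule.span_induction with
  | zero => simp
  | add a b _ _ ha hb => simp [ha, hb]
  | smul c a _ ha => simp [ha]
  | mem a ha =>
    obtain ⟨u, -, v, -, rfl⟩ := ha
    induction hy using Submodule.span_induction with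
    | zero => simp
    | add a b _ _ ha hb => simp [ha, hb]
    | smul c a _ ha => simp [ha]
    | mem b hb =>
      obtain ⟨w, -, z, -, rfl⟩ := hb
      exact hσ.apply_lie_lie u v w z

theorem _root_.IsSymplecticForm.apply_leftSymmetricProduct (hσ : IsSymplecticForm σ) (u v w : L) :
    σ (leftSymmetricProduct σ hσ.nondegenerate u v) w = -σ v ⁅u, w⁆ := by
  change σ (-adAdjoint σ hσ.nondegenerate u v) w = _
  rw [map_neg, LinearMap.neg_apply, adAdjoint_spec]

/-- The covariant derivative of `σ` with respect to the left-symmetric product. -/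
theorem _root_.IsSymplecticForm.apply_leftSymmetricProduct_add (hσ : IsSymplecticForm σ) (u v w : L) :
    σ (leftSymmetricProduct σ hσ.nondegenerate u v) w +
      σ v (leftSymmetricProduct σ hσ.nondegenerate u w) = -σ u ⁅v, w⁆ := by
  rw [← hσ.alt.neg_eq _ v, hσ.apply_leftSymmetricProduct, hσ.apply_leftSymmetricProduct]
  have h := hσ.closed u v w
  have h₁ : σ ⁅v, w⁆ u = -σ u ⁅v, w⁆ := (hσ.alt.neg_eq _ _).symm
  have h₂ : σ ⁅w, u⁆ v = σ v ⁅u, w⁆ := by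
    rw [← hσ.alt.neg_eq, ← lie_skew u w, map_neg]
  have h₃ : σ ⁅u, v⁆ w = -σ w ⁅u, v⁆ := (hσ.alt.neg_eq _ _).symm
  rw [h₁, h₂, h₃] at h
  linear_combination -h

/-- The second covariant derivative of `σ` with respect to the left-symmetric product vanishes. -/
theorem apply_leftSymmetricProduct_lie_add [NeZero (2 : K)] (hσ : IsSymplecticPoissonAlgebra σ)
    (a u v w : L) :
    σ (leftSymmetricProduct σ hσ.nondegenerate a u) ⁅v, w⁆ +
      σ u (⁅leftSymmetricProduct σ hσ.nondegenerate a v, w⁆ +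
        ⁅v, leftSymmetricProduct σ hσ.nondegenerate a w⁆) = 0 := by
  -- Once the adjoint is outside the bracket, moving it across σ leaves a pairing of two brackets,
  -- which isotropy kills.
  have key : ∀ u v w : L, σ u ⁅v, leftSymmetricProduct σ hσ.nondegenerate a w⁆ = 0 := fun u v w => by
    change σ u ⁅v, -adAdjoint σ hσ.nondegenerate a w⁆ = 0
    rw [lie_neg, hσ.lie_adAdjoint, map_neg, hσ.alt.neg_eq, adAdjoint_spec, hσ.apply_lie_lie]
  rw [hσ.toIsSymplecticForm.apply_leftSymmetricProduct, map_add, key,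
    ← lie_skew (leftSymmetricProduct σ hσ.nondegenerate a v) w, map_neg, key, ← lie_skew a,
    hσ.two_nilpotent]
  simp

end IsSymplecticPoissonAlgebra

/-! ### Smoothness and the Leibniz rule for bilinear expressions. -/

section Bilinear

variable {E : Type*} [NormedAddCommGroup E] [NormedSpace ℝ E]
  {H : Type*} [TopologicalSpace H] {I : ModelWithCorners ℝ E H}
  {M : Type*} [TopologicalSpace M] [ChartedSpace H M]
  {F₁ F₂ F₃ : Type*} [NormedAddCommGroup F₁] [NormedSpace ℝ F₁] [FiniteDimensional ℝ F₁]
  [NormedAddCommGroup F₂] [NormedSpace ℝ F₂] [FiniteDimensional ℝ F₂]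
  [NormedAddCommGroup F₃] [NormedSpace ℝ F₃]

theorem ContMDiff.bilinear (B : F₁ →ₗ[ℝ] F₂ →ₗ[ℝ] F₃) {n : ℕ∞ω} {y : M → F₁} {z : M → F₂}
    (hy : ContMDiff I 𝓘(ℝ, F₁) n y) (hz : ContMDiff I 𝓘(ℝ, F₂) n z) :
    ContMDiff I 𝓘(ℝ, F₃) n fun m => B (y m) (z m) :=
  (B.toContinuousBilinearMap.isBoundedBilinearMap.contDiff.contMDiff).comp (hy.prodMk_space hz)

theorem MDifferentiableAt.mvfderiv_bilinear (B : F₁ →ₗ[ℝ] F₂ →ₗ[ℝ] F₃) {y : M → F₁} {z : M → F₂}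
    {x : M} (hy : MDifferentiableAt I 𝓘(ℝ, F₁) y x) (hz : MDifferentiableAt I 𝓘(ℝ, F₂) z x) :
    MDifferentiableAt I 𝓘(ℝ, F₃) (fun m => B (y m) (z m)) x ∧
    ∀ v : TangentSpace I x, mvfderiv I (fun m => B (y m) (z m)) x v =
      B (mvfderiv I y x v) (z x) + B (y x) (mvfderiv I z x v) := by
  have hB := (B.toContinuousBilinearMap.isBoundedBilinearMap.hasFDerivAt (y x, z x)).hasMFDerivAt
  have hyz : HasMFDerivAt I 𝓘(ℝ, F₁ × F₂) (fun m => (y m, z m)) x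
      ((mvfderiv I y x).prod (mvfderiv I z x)) :=
    ⟨hy.hasMFDerivAt.1.prodMk hz.hasMFDerivAt.1, hy.hasMFDerivAt.2.prodMk hz.hasMFDerivAt.2⟩
  have h := HasMFDerivAt.comp (f := fun m => (y m, z m)) x hB hyz
  refine ⟨h.mdifferentiableAt, fun v => ?_⟩
  have h' := h.mfderiv
  change (mfderiv I 𝓘(ℝ, F₃) (fun m => B (y m) (z m)) x : E →L[ℝ] F₃) v = _
  erw [h']
  change B (y x) (mvfderiv I z x v) + B (mvfderiv I y x v) (z x) = _
  exact add_comm _ _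

end Bilinear

/-! ### Smoothness of the left trivialization. -/

section LeftTrivialization

variable {E : Type*} [NormedAddCommGroup E] [NormedSpace ℝ E]
  {H : Type*} [TopologicalSpace H] {I : ModelWithCorners ℝ E H}
  {G : Type*} [TopologicalSpace G] [ChartedSpace H G] [Group G] [LieGroup I ∞ G]

/-- Expresses the differential of a left translation through the differential of the multiplication
map, which is jointly smooth. This gives smooth dependence on `g`. -/
theorem tangentMap_mul_symm_apply (g h : G) (v : TangentSpace I h) :
    tangentMap (I.prod I) I (fun p : G × G => p.1 * p.2)
      ((equivTangentBundleProd I G I G).symm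
        ((⟨g, 0⟩ : TangentBundle I G), (⟨h, v⟩ : TangentBundle I G))) =
      ⟨g * h, mfderiv I I (g * ·) h v⟩ := by
  have hn : (∞ : ℕ∞ω) ≠ 0 := by simp
  refine TotalSpace.ext (by simp [tangentMap]) ?_
  simp only [tangentMap, equivTangentBundleProd_symm_apply_snd]
  have e := mfderiv_prod_eq_add_apply (I := I) (I' := I) (I'' := I)
    (f := fun p : G × G => p.1 * p.2) (p := (g, h)) (v := ((0 : E), (v : E)))
    (((contMDiff_mul I ∞).contMDiffAt (x := (g, h))).mdifferentiableAt hn)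
  refine heq_of_eq (e.trans ?_)
  have e0 : mfderiv I I (fun z : G => z * h) g (0 : E) = 0 := map_zero _
  change (mfderiv I I (fun z : G => z * h) g (0 : E) : E) + _ = _
  erw [e0]
  exact zero_add _

theorem contMDiff_tangentMap_mul_symm {γ : G → G} (hγ : ContMDiff I I ∞ γ) {η : G → TangentBundle I G}
    (hη : ContMDiff I I.tangent ∞ η) :
    ContMDiff I I.tangent ∞ fun g => tangentMap (I.prod I) I (fun p : G × G => p.1 * p.2)
      ((equivTangentBundleProd I G I G).symm ((⟨γ g, 0⟩ : TangentBundle I G), η g)) := by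
  have h₁ : ContMDiff I I.tangent ∞ fun g : G => (TotalSpace.mk' E g 0 : TangentBundle I G) :=
    contMDiff_zeroSection _ _
  have h₂ : ContMDiff (I.prod I).tangent I.tangent ∞
      (tangentMap (I.prod I) I fun p : G × G => p.1 * p.2) :=
    (contMDiff_mul I ∞).contMDiff_tangentMap (m := ∞) (by simp)
  exact h₂.comp (contMDiff_equivTangentBundleProd_symm.comp ((h₁.comp hγ).prodMk hη))

theorem ContMDiff.leftComponent {Y : Π g : G, TangentSpace I g}
    (hY : ContMDiff I I.tangent ∞ fun g => (⟨g, Y g⟩ : TangentBundle I G)) :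
    ContMDiff I 𝓘(ℝ, E) ∞ (leftComponent Y) := by
  have h := contMDiff_tangentMap_mul_symm (contMDiff_inv I ∞) hY
  have key : (fun g => tangentMap (I.prod I) I (fun p : G × G => p.1 * p.2)
      ((equivTangentBundleProd I G I G).symm ((⟨g⁻¹, 0⟩ : TangentBundle I G), ⟨g, Y g⟩))) =
      fun g => TotalSpace.mk' E (1 : G) (leftTrivialize I g (Y g)) := by
    funext g
    rw [tangentMap_mul_symm_apply]
    refine TotalSpace.ext (inv_mul_cancel g) ?_
    rw [leftTrivialize_eq]
    rfl
  rw [key] at h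
  intro g
  refine ((contMDiffAt_totalSpace).1 (h g)).2.congr_of_eventuallyEq
    (Filter.Eventually.of_forall fun h => ?_)
  -- All values lie in the fibre over 1, where the trivialization at 1 is the identity.
  exact ((tangentBundleCore I G).coordChange_self (achart H (1 : G)) 1 (mem_achart_source H (1 : G))
    (leftTrivialize I h (Y h))).symm

theorem ContMDiff.leftTranslate {c : G → E} (hc : ContMDiff I 𝓘(ℝ, E) ∞ c) :
    ContMDiff I I.tangent ∞ fun g => (⟨g, leftTranslate I g (c g)⟩ : TangentBundle I G) := by
  have h₁ : ContMDiff I I.tangent ∞ fun g : G => (⟨1, c g⟩ : TangentBundle I G) := by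
    intro g
    refine (contMDiffAt_totalSpace).2 ⟨contMDiffAt_const, (hc g).congr_of_eventuallyEq
      (Filter.Eventually.of_forall fun h => ?_)⟩
    exact (tangentBundleCore I G).coordChange_self (achart H (1 : G)) 1
      (mem_achart_source H (1 : G)) (c h)
  have h := contMDiff_tangentMap_mul_symm (contMDiff_id (I := I) (n := ∞) (M := G)) h₁
  have key : (fun g => tangentMap (I.prod I) I (fun p : G × G => p.1 * p.2)
      ((equivTangentBundleProd I G I G).symm
        ((⟨id g, 0⟩ : TangentBundle I G), (⟨1, c g⟩ : TangentBundle I G)))) =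
      fun g => ⟨g, _root_.leftTranslate I g (c g)⟩ := by
    funext g
    refine (tangentMap_mul_symm_apply g 1 (c g)).trans (TotalSpace.ext (mul_one g) ?_)
    rfl
  rwa [key] at h

theorem ContMDiff.mvfderiv_apply {F : Type*} [NormedAddCommGroup F] [NormedSpace ℝ F] {f : G → F}
    (hf : ContMDiff I 𝓘(ℝ, F) ∞ f) {X : Π g : G, TangentSpace I g}
    (hX : ContMDiff I I.tangent ∞ fun g => (⟨g, X g⟩ : TangentBundle I G)) :
    ContMDiff I 𝓘(ℝ, F) ∞ fun g => mvfderiv I f g (X g) := by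
  have : IsManifold I 1 G := IsManifold.of_le (n := ∞) (by simp)
  have h := (hf.contMDiff_tangentMap (m := ∞) (by simp)).comp hX
  intro g
  refine ((contMDiffAt_totalSpace).1 (h g)).2.congr_of_eventuallyEq
    (Filter.Eventually.of_forall fun h => ?_)
  simp [tangentMap]
  rfl

end LeftTrivialization

/-! ### Left-invariant connections and the tensor T. -/

section LeftInvariantConnection

variable {E : Type*} [NormedAddCommGroup E] [NormedSpace ℝ E] [FiniteDimensional ℝ E]
  {H : Type*} [TopologicalSpace H] {I : ModelWithCorners ℝ E H}
  {G : Type*} [TopologicalSpace G] [ChartedSpace H G] [Group G] [LieGroup I ∞ G]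

theorem leftTrivialize_leftInvariantConnection
    (α : GroupLieAlgebra I G →ₗ[ℝ] GroupLieAlgebra I G →ₗ[ℝ] GroupLieAlgebra I G)
    (Y : Π g : G, TangentSpace I g) (g : G) (v : TangentSpace I g) :
    leftTrivialize I g (leftInvariantConnection α Y g v) =
      leftDeriv Y g v + α (leftTrivialize I g v) (leftTrivialize I g (Y g)) :=
  leftTrivialize_leftTranslate g _

theorem ContMDiff.leftInvariantConnection
    (α : GroupLieAlgebra I G →ₗ[ℝ] GroupLieAlgebra I G →ₗ[ℝ] GroupLieAlgebra I G)
    {X Y : Π g : G, TangentSpace I g}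
    (hX : ContMDiff I I.tangent ∞ fun g => (⟨g, X g⟩ : TangentBundle I G))
    (hY : ContMDiff I I.tangent ∞ fun g => (⟨g, Y g⟩ : TangentBundle I G)) :
    ContMDiff I I.tangent ∞ fun g =>
      (⟨g, leftInvariantConnection α Y g (X g)⟩ : TangentBundle I G) :=
  ((hY.leftComponent.mvfderiv_apply hX).add
    (ContMDiff.bilinear (F₁ := E) (F₂ := E) (F₃ := E) α hX.leftComponent hY.leftComponent)).leftTranslate

theorem mdifferentiableAt_leftComponent_bilinear {F : Type*} [NormedAddCommGroup F] [NormedSpace ℝ F]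
    (B : GroupLieAlgebra I G →ₗ[ℝ] GroupLieAlgebra I G →ₗ[ℝ] F) {Y Z : Π g : G, TangentSpace I g} {g : G}
    (hY : MDiffAt (T% Y) g) (hZ : MDiffAt (T% Z) g) :
    MDifferentiableAt I 𝓘(ℝ, F) (fun h => B (leftTrivialize I h (Y h)) (leftTrivialize I h (Z h))) g :=
  (MDifferentiableAt.mvfderiv_bilinear (F₁ := E) (F₂ := E) (B : E →ₗ[ℝ] E →ₗ[ℝ] F) (mdifferentiableAt_leftComponent hY)
    (mdifferentiableAt_leftComponent hZ)).1

theorem mvfderiv_leftComponent_bilinear {F : Type*} [NormedAddCommGroup F] [NormedSpace ℝ F]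
    (B : GroupLieAlgebra I G →ₗ[ℝ] GroupLieAlgebra I G →ₗ[ℝ] F) {Y Z : Π g : G, TangentSpace I g} {g : G}
    (hY : MDiffAt (T% Y) g) (hZ : MDiffAt (T% Z) g) (v : TangentSpace I g) :
    mvfderiv I (fun h => B (leftTrivialize I h (Y h)) (leftTrivialize I h (Z h))) g v =
      B (leftDeriv Y g v) (leftTrivialize I g (Z g)) +
        B (leftTrivialize I g (Y g)) (leftDeriv Z g v) :=
  (MDifferentiableAt.mvfderiv_bilinear (F₁ := E) (F₂ := E) (B : E →ₗ[ℝ] E →ₗ[ℝ] F) (mdifferentiableAt_leftComponent hY)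
    (mdifferentiableAt_leftComponent hZ)).2 v

variable [CompleteSpace E]

variable (I G) in
/-- The Lie bracket of a Lie group as a bilinear map. -/
noncomputable def lieBilinear :
    GroupLieAlgebra I G →ₗ[ℝ] GroupLieAlgebra I G →ₗ[ℝ] GroupLieAlgebra I G :=
  LinearMap.mk₂ ℝ (fun u v => ⁅u, v⁆) add_lie smul_lie lie_add lie_smul

/-- The trilinear form `σ u ⁅v, w⁆` evaluated on vector fields in the left trivialization. -/
noncomputable def bracketTensor (σ : LinearMap.BilinForm ℝ (GroupLieAlgebra I G))
    (X : Fin 3 → Π g : G, TangentSpace I g) (g : G) : ℝ :=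
  σ (leftTrivialize I g (X 0 g)) ⁅leftTrivialize I g (X 1 g), leftTrivialize I g (X 2 g)⁆

theorem mdifferentiableAt_bracketTensor (σ : LinearMap.BilinForm ℝ (GroupLieAlgebra I G))
    {X : Fin 3 → Π g : G, TangentSpace I g} {g : G} (hX : ∀ i, MDiffAt (T% (X i)) g) :
    MDifferentiableAt I 𝓘(ℝ, ℝ) (bracketTensor σ X) g :=
  (MDifferentiableAt.mvfderiv_bilinear (F₁ := E) (F₂ := E) σ
    (mdifferentiableAt_leftComponent (hX 0))
    (mdifferentiableAt_leftComponent_bilinear (F := E)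
      (lieBilinear I G) (hX 1) (hX 2))).1

theorem mvfderiv_bracketTensor (σ : LinearMap.BilinForm ℝ (GroupLieAlgebra I G))
    {X : Fin 3 → Π g : G, TangentSpace I g} {g : G} (hX : ∀ i, MDiffAt (T% (X i)) g)
    (v : TangentSpace I g) :
    mvfderiv I (bracketTensor σ X) g v =
      σ (leftDeriv (X 0) g v) ⁅leftTrivialize I g (X 1 g), leftTrivialize I g (X 2 g)⁆ +
      σ (leftTrivialize I g (X 0 g))
        (⁅leftDeriv (X 1) g v, leftTrivialize I g (X 2 g)⁆ +
          ⁅leftTrivialize I g (X 1 g), leftDeriv (X 2) g v⁆) := by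
  have h := (MDifferentiableAt.mvfderiv_bilinear (F₁ := E) (F₂ := E) σ
    (mdifferentiableAt_leftComponent (hX 0))
    (mdifferentiableAt_leftComponent_bilinear (F := E)
      (lieBilinear I G) (hX 1) (hX 2))).2 v
  have h' := mvfderiv_leftComponent_bilinear (F := E)
      (lieBilinear I G) (hX 1) (hX 2) v
  erw [h'] at h
  exact h

end LeftInvariantConnection

/-! ### Covariant derivatives of Ω. -/

section SymplecticAffineConnection

variable {E : Type*} [NormedAddCommGroup E] [NormedSpace ℝ E] [FiniteDimensional ℝ E]
  [CompleteSpace E]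
  {H : Type*} [TopologicalSpace H] {I : ModelWithCorners ℝ E H}
  {G : Type*} [TopologicalSpace G] [ChartedSpace H G] [Group G] [LieGroup I ∞ G]
  {σ : LinearMap.BilinForm ℝ (GroupLieAlgebra I G)}

theorem leftDeriv_eq_sub (hσ : σ.Nondegenerate) (Y : Π g : G, TangentSpace I g) (g : G)
    (v : TangentSpace I g) :
    leftDeriv Y g v = leftTrivialize I g (symplecticAffineConnection σ hσ Y g v) -
      leftSymmetricProduct σ hσ (leftTrivialize I g v) (leftTrivialize I g (Y g)) := by
  rw [symplecticAffineConnection, leftTrivialize_leftInvariantConnection, add_sub_cancel_right]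

/-- Only the fields are differentiated, since Ω has constant coefficients in the left
trivialization. Writing their derivatives as ∇ minus the product leaves a defect, which closedness
of σ collapses to the bracket term. This form serves both for computing ∇Ω and in affine charts,
where the terms with ∇ drop out. -/
theorem mvfderiv_bilinTensor_leftInvariantForm (hσ : IsSymplecticForm σ)
    {X : Fin 2 → Π g : G, TangentSpace I g} {g : G} (hX : ∀ i, MDiffAt (T% (X i)) g)
    (v : TangentSpace I g) :
    mvfderiv I (bilinTensor (leftInvariantForm σ) X) g v =
      leftInvariantForm σ g (symplecticAffineConnection σ hσ.nondegenerate (X 0) g v) (X 1 g) +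
      leftInvariantForm σ g (X 0 g) (symplecticAffineConnection σ hσ.nondegenerate (X 1) g v) +
      σ (leftTrivialize I g v) ⁅leftTrivialize I g (X 0 g), leftTrivialize I g (X 1 g)⁆ := by
  refine (mvfderiv_leftComponent_bilinear σ (hX 0) (hX 1) v).trans ?_
  rw [leftDeriv_eq_sub hσ.nondegenerate, leftDeriv_eq_sub hσ.nondegenerate, map_sub, map_sub,
    LinearMap.sub_apply]
  have h := hσ.apply_leftSymmetricProduct_add (leftTrivialize I g v)
    (leftTrivialize I g (X 0 g)) (leftTrivialize I g (X 1 g))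
  change _ = σ (leftTrivialize I g _) (leftTrivialize I g _) +
    σ (leftTrivialize I g _) (leftTrivialize I g _) + _
  linear_combination -h

/-- The product terms cancel because T is parallel at the algebraic level. As `v` lives only at `g`,
the derivative of `X i` along it is a single vector; it is extended to a left-invariant field so
that it can fill a slot of T, and the choice of extension is immaterial because T is pointwise. -/
theorem mvfderiv_bracketTensor_eq (hσ : IsSymplecticPoissonAlgebra σ)
    {X : Fin 3 → Π g : G, TangentSpace I g} {g : G} (hX : ∀ i, MDiffAt (T% (X i)) g)
    (v : TangentSpace I g) :
    mvfderiv I (bracketTensor σ X) g v =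
      ∑ i, bracketTensor σ (Function.update X i fun h =>
        leftTranslate I h (leftTrivialize I g
          (symplecticAffineConnection σ hσ.nondegenerate (X i) g v))) g := by
  rw [mvfderiv_bracketTensor σ hX, leftDeriv_eq_sub hσ.nondegenerate,
    leftDeriv_eq_sub hσ.nondegenerate, leftDeriv_eq_sub hσ.nondegenerate]
  have h := hσ.apply_leftSymmetricProduct_lie_add (leftTrivialize I g v)
    (leftTrivialize I g (X 0 g)) (leftTrivialize I g (X 1 g)) (leftTrivialize I g (X 2 g))
  simp only [Fin.sum_univ_three, bracketTensor, Function.update_self, leftTrivialize_leftTranslate,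
    Function.update_of_ne (show (1 : Fin 3) ≠ 0 by decide),
    Function.update_of_ne (show (2 : Fin 3) ≠ 0 by decide),
    Function.update_of_ne (show (0 : Fin 3) ≠ 1 by decide),
    Function.update_of_ne (show (2 : Fin 3) ≠ 1 by decide),
    Function.update_of_ne (show (0 : Fin 3) ≠ 2 by decide),
    Function.update_of_ne (show (1 : Fin 3) ≠ 2 by decide)]
  simp only [map_sub, LinearMap.sub_apply, map_add, sub_lie, lie_sub] at h ⊢
  linear_combination -h

omit [FiniteDimensional ℝ E] [CompleteSpace E] [LieGroup I ∞ G] in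
theorem bracketTensor_congr {X Y : Fin 3 → Π g : G, TangentSpace I g} {g : G}
    (h : ∀ i, X i g = Y i g) : bracketTensor σ X g = bracketTensor σ Y g := by
  simp only [bracketTensor, h]

theorem covTensorDeriv_leftInvariantForm [IsManifold I 1 G] (hσ : IsSymplecticForm σ)
    {X : Fin 3 → Π g : G, TangentSpace I g} {g : G} (hX : ∀ i, MDiffAt (T% (X i)) g) :
    covTensorDeriv (symplecticAffineConnection σ hσ.nondegenerate)
      (bilinTensor (leftInvariantForm σ)) X g = bracketTensor σ X g := by
  rw [covTensorDeriv, mvfderiv_bilinTensor_leftInvariantForm hσ (X := Fin.tail X) fun i => hX i.succ]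
  simp only [Fin.sum_univ_two, bilinTensor, Function.update_self,
    Function.update_of_ne (show (1 : Fin 2) ≠ 0 by decide),
    Function.update_of_ne (show (0 : Fin 2) ≠ 1 by decide)]
  exact add_sub_cancel_left _ _

theorem covTensorDeriv_bracketTensor [IsManifold I 1 G] (hσ : IsSymplecticPoissonAlgebra σ)
    {X : Fin 4 → Π g : G, TangentSpace I g} {g : G} (hX : ∀ i, MDiffAt (T% (X i)) g) :
    covTensorDeriv (symplecticAffineConnection σ hσ.nondegenerate) (bracketTensor σ) X g = 0 := by
  rw [covTensorDeriv, mvfderiv_bracketTensor_eq hσ (X := Fin.tail X) fun i => hX i.succ, sub_eq_zero]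
  refine Finset.sum_congr rfl fun i _ => bracketTensor_congr fun j => ?_
  obtain rfl | h := eq_or_ne j i
  · simp only [Function.update_self, leftTranslate_leftTrivialize]
  · simp only [Function.update_of_ne h]

omit [CompleteSpace E] in
theorem ContMDiff.update_symplecticAffineConnection (hσ : σ.Nondegenerate) {k : ℕ}
    {X : Fin (k + 1) → Π g : G, TangentSpace I g}
    (hX : ∀ i, ContMDiff I I.tangent ∞ fun g => (⟨g, X i g⟩ : TangentBundle I G)) (i j : Fin k) :
    ContMDiff I I.tangent ∞ fun g => (⟨g, Function.update (Fin.tail X) i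
      (fun h => symplecticAffineConnection σ hσ (Fin.tail X i) h (X 0 h)) j g⟩ :
        TangentBundle I G) := by
  obtain rfl | h := eq_or_ne j i
  · simp only [Function.update_self]
    exact ContMDiff.leftInvariantConnection _ (hX 0) (hX _)
  · simp only [Function.update_of_ne h]
    exact hX _

omit [CompleteSpace E] in
/-- Covariant derivatives on smooth vector fields depend on the tensor only through its values on
smooth vector fields. -/
theorem covTensorDeriv_congr [IsManifold I 1 G] (hσ : σ.Nondegenerate) {k : ℕ}
    {S T : (Fin k → Π g : G, TangentSpace I g) → G → ℝ}
    (h : ∀ X : Fin k → Π g : G, TangentSpace I g,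
      (∀ i, ContMDiff I I.tangent ∞ fun g => (⟨g, X i g⟩ : TangentBundle I G)) → S X = T X)
    {X : Fin (k + 1) → Π g : G, TangentSpace I g}
    (hX : ∀ i, ContMDiff I I.tangent ∞ fun g => (⟨g, X i g⟩ : TangentBundle I G)) :
    covTensorDeriv (symplecticAffineConnection σ hσ) S X =
      covTensorDeriv (symplecticAffineConnection σ hσ) T X := by
  funext g
  rw [covTensorDeriv, covTensorDeriv, h (Fin.tail X) fun i => hX i.succ]
  congr 1
  exact Finset.sum_congr rfl fun i _ => by
    rw [h _ (ContMDiff.update_symplecticAffineConnection hσ hX i)]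

/-- The first derivative agrees with T only on differentiable fields, so the substitution under the
second derivative goes through `covTensorDeriv_congr`. -/
theorem iteratedCovTensorDeriv_two_leftInvariantForm [IsManifold I 1 G]
    (hσ : IsSymplecticPoissonAlgebra σ) {X : Fin (2 + 2) → Π g : G, TangentSpace I g}
    (hX : ∀ i, ContMDiff I I.tangent ∞ fun g => (⟨g, X i g⟩ : TangentBundle I G)) :
    iteratedCovTensorDeriv (symplecticAffineConnection σ hσ.nondegenerate)
      (bilinTensor (leftInvariantForm σ)) 2 X = 0 := by
  have hd {k : ℕ} {X : Fin k → Π g : G, TangentSpace I g}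
      (hX : ∀ i, ContMDiff I I.tangent ∞ fun g => (⟨g, X i g⟩ : TangentBundle I G)) (g : G) (i) :
      MDiffAt (T% (X i)) g := (hX i).mdifferentiable (by simp) g
  refine (covTensorDeriv_congr hσ.nondegenerate (T := bracketTensor σ) (fun X hX => ?_) hX).trans ?_
  · exact funext fun g => covTensorDeriv_leftInvariantForm hσ.toIsSymplecticForm (hd hX g)
  · exact funext fun g => covTensorDeriv_bracketTensor hσ (hd hX g)

theorem iteratedCovTensorDeriv_three_leftInvariantForm [IsManifold I 1 G]
    (hσ : IsSymplecticPoissonAlgebra σ) {X : Fin (2 + 3) → Π g : G, TangentSpace I g}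
    (hX : ∀ i, ContMDiff I I.tangent ∞ fun g => (⟨g, X i g⟩ : TangentBundle I G)) :
    iteratedCovTensorDeriv (symplecticAffineConnection σ hσ.nondegenerate)
      (bilinTensor (leftInvariantForm σ)) 3 X = 0 := by
  refine (covTensorDeriv_congr hσ.nondegenerate (T := fun _ => 0)
    (fun X hX => iteratedCovTensorDeriv_two_leftInvariantForm hσ hX) hX).trans ?_
  funext g
  simp [covTensorDeriv]

end SymplecticAffineConnection

/-! ### Coordinate fields and partial derivatives in a chart. -/

section CoordinateFields

variable {E : Type*} [NormedAddCommGroup E] [NormedSpace ℝ E]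
  {M : Type*} [TopologicalSpace M] [ChartedSpace E M] {φ : OpenPartialHomeomorph M E}

theorem mdifferentiable_of_mem_maximalAtlas (hφ : φ ∈ IsManifold.maximalAtlas 𝓘(ℝ, E) ∞ M) :
    φ.MDifferentiable 𝓘(ℝ, E) 𝓘(ℝ, E) :=
  ⟨(contMDiffOn_of_mem_maximalAtlas hφ).mdifferentiableOn (by simp),
    (contMDiffOn_symm_of_mem_maximalAtlas hφ).mdifferentiableOn (by simp)⟩

theorem isInvertible_mfderiv_of_mem_maximalAtlas [IsManifold 𝓘(ℝ, E) 1 M]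
    (hφ : φ ∈ IsManifold.maximalAtlas 𝓘(ℝ, E) ∞ M) {x : M} (hx : x ∈ φ.source) :
    (mfderiv 𝓘(ℝ, E) 𝓘(ℝ, E) φ x).IsInvertible :=
  ⟨(mdifferentiable_of_mem_maximalAtlas hφ).mfderiv hx, rfl⟩

theorem coordField_mfderiv [IsManifold 𝓘(ℝ, E) 1 M]
    (hφ : φ ∈ IsManifold.maximalAtlas 𝓘(ℝ, E) ∞ M) {x : M} (hx : x ∈ φ.source)
    (v : TangentSpace 𝓘(ℝ, E) x) :
    coordField φ (mfderiv 𝓘(ℝ, E) 𝓘(ℝ, E) φ x v) x = v :=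
  (isInvertible_mfderiv_of_mem_maximalAtlas hφ hx).inverse_apply_self v

theorem mfderiv_symm_apply [IsManifold 𝓘(ℝ, E) 1 M]
    (hφ : φ ∈ IsManifold.maximalAtlas 𝓘(ℝ, E) ∞ M) {y : E} (hy : y ∈ φ.target) (e : E) :
    mfderiv 𝓘(ℝ, E) 𝓘(ℝ, E) φ.symm y e = coordField φ e (φ.symm y) := by
  have h := DFunLike.congr_fun ((mdifferentiable_of_mem_maximalAtlas hφ).comp_symm_deriv hy) e
  change mfderiv 𝓘(ℝ, E) 𝓘(ℝ, E) φ (φ.symm y) (mfderiv 𝓘(ℝ, E) 𝓘(ℝ, E) φ.symm y e) = e at h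
  rw [← coordField_mfderiv hφ (φ.map_target hy) (mfderiv 𝓘(ℝ, E) 𝓘(ℝ, E) φ.symm y e)]
  exact congrArg (fun e => coordField φ e (φ.symm y)) h

theorem mdifferentiableAt_coordField [CompleteSpace E] [IsManifold 𝓘(ℝ, E) 2 M]
    [IsManifold 𝓘(ℝ, E) 1 M]
    (hφ : φ ∈ IsManifold.maximalAtlas 𝓘(ℝ, E) ∞ M) {x : M} (hx : x ∈ φ.source) (e : E) :
    MDiffAt (T% (coordField φ e)) x := by
  refine MDifferentiableAt.mpullback_vectorField (n := ∞) ?_ (contMDiffAt_of_mem_maximalAtlas hφ hx)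
    (isInvertible_mfderiv_of_mem_maximalAtlas hφ hx) (WithTop.coe_le_coe.2 (le_top : (2 : ℕ∞) ≤ ⊤))
  exact ((contMDiff_vectorSpace_iff_contDiff (n := 1)).2 contDiff_const).mdifferentiable
    one_ne_zero _

theorem fderiv_comp_symm [IsManifold 𝓘(ℝ, E) 1 M]
    (hφ : φ ∈ IsManifold.maximalAtlas 𝓘(ℝ, E) ∞ M) {f : M → ℝ} {y : E} (hy : y ∈ φ.target)
    (hf : MDifferentiableAt 𝓘(ℝ, E) 𝓘(ℝ, ℝ) f (φ.symm y)) :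
    DifferentiableAt ℝ (f ∘ φ.symm) y ∧ ∀ e : E, fderiv ℝ (f ∘ φ.symm) y e =
      mvfderiv 𝓘(ℝ, E) f (φ.symm y) (coordField φ e (φ.symm y)) := by
  have hs := (mdifferentiable_of_mem_maximalAtlas hφ).mdifferentiableAt_symm hy
  refine ⟨(hf.comp y hs).differentiableAt, fun e => ?_⟩
  rw [← mfderiv_symm_apply hφ hy, ← mfderiv_eq_fderiv, mfderiv_comp y hf hs]
  rfl

end CoordinateFields

/-! ### The components of Ω in an affine chart. -/

section AffineCharts

variable {E : Type*} [NormedAddCommGroup E] [NormedSpace ℝ E] [FiniteDimensional ℝ E]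
  [CompleteSpace E]
  {G : Type*} [TopologicalSpace G] [ChartedSpace E G] [Group G] [LieGroup 𝓘(ℝ, E) ∞ G]
  {σ : LinearMap.BilinForm ℝ (GroupLieAlgebra 𝓘(ℝ, E) G)} {φ : OpenPartialHomeomorph G E}

/-- In an affine chart the left-invariant form has affine components, whose linear parts are given
by the tensor `σ u ⁅v, w⁆`. -/
theorem exists_affine_leftInvariantForm [IsManifold 𝓘(ℝ, E) 1 G] [IsManifold 𝓘(ℝ, E) 2 G]
    (hσ : IsSymplecticPoissonAlgebra σ)
    (hφ : IsAffineChart (symplecticAffineConnection σ hσ.nondegenerate) φ)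
    (hc : IsConnected φ.source) (a b : E) :
    ∃ (L : E →L[ℝ] ℝ) (c : ℝ), ∀ x ∈ φ.source,
      leftInvariantForm σ x (coordField φ a x) (coordField φ b x) = L (φ x) + c ∧
      ∀ e, L e = bracketTensor σ ![coordField φ e, coordField φ a, coordField φ b] x := by
  have hA := hφ.mem_maximalAtlas
  have ht : IsPreconnected φ.target := by
    rw [← φ.image_source_eq_target]
    exact hc.isPreconnected.image _ φ.continuousOn
  have hd₂ : ∀ x ∈ φ.source, ∀ i, MDiffAt (T% (![coordField φ a, coordField φ b] i)) x := by
    intro x hx i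
    fin_cases i
    exacts [mdifferentiableAt_coordField hA hx a, mdifferentiableAt_coordField hA hx b]
  have hd₃ : ∀ e, ∀ x ∈ φ.source, ∀ i,
      MDiffAt (T% (![coordField φ e, coordField φ a, coordField φ b] i)) x := by
    intro e x hx i
    fin_cases i
    exacts [mdifferentiableAt_coordField hA hx e, mdifferentiableAt_coordField hA hx a,
      mdifferentiableAt_coordField hA hx b]
  have hmd : ∀ x ∈ φ.source, MDifferentiableAt 𝓘(ℝ, E) 𝓘(ℝ, ℝ)
      (bilinTensor (leftInvariantForm σ) ![coordField φ a, coordField φ b]) x := fun x hx =>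
    mdifferentiableAt_leftComponent_bilinear σ (hd₂ x hx 0) (hd₂ x hx 1)
  have h₁ : ∀ y ∈ φ.target, ∀ e,
      fderiv ℝ (bilinTensor (leftInvariantForm σ) ![coordField φ a, coordField φ b] ∘ φ.symm) y e =
        bracketTensor σ ![coordField φ e, coordField φ a, coordField φ b] (φ.symm y) := by
    intro y hy e
    have hx := φ.map_target hy
    rw [(fderiv_comp_symm hA hy (hmd _ hx)).2,
      mvfderiv_bilinTensor_leftInvariantForm hσ.toIsSymplecticForm (hd₂ _ hx)]
    have ha := hφ.parallel a _ hx
    have hb := hφ.parallel b _ hx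
    simp only [Matrix.cons_val_zero, Matrix.cons_val_one, ha, hb, zero_apply, map_zero,
      LinearMap.zero_apply, zero_add]
    rfl
  -- T is parallel and so are the coordinate fields, so its components have zero derivative on the
  -- connected target.
  have h₂ : ∀ e, ∃ r : ℝ, ∀ y ∈ φ.target,
      bracketTensor σ ![coordField φ e, coordField φ a, coordField φ b] (φ.symm y) = r := by
    intro e
    have hm : ∀ y ∈ φ.target, MDifferentiableAt 𝓘(ℝ, E) 𝓘(ℝ, ℝ)
        (bracketTensor σ ![coordField φ e, coordField φ a, coordField φ b]) (φ.symm y) :=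
      fun y hy => mdifferentiableAt_bracketTensor σ (hd₃ e _ (φ.map_target hy))
    refine φ.open_target.exists_is_const_of_fderiv_eq_zero (𝕜 := ℝ) ht
      (fun y hy => (fderiv_comp_symm hA hy (hm y hy)).1.differentiableWithinAt)
      fun y hy => ?_
    ext v
    have hx := φ.map_target hy
    refine ((fderiv_comp_symm hA hy (hm y hy)).2 v).trans ?_
    rw [mvfderiv_bracketTensor_eq hσ (hd₃ e _ hx)]
    have he := hφ.parallel e _ hx
    have ha := hφ.parallel a _ hx
    have hb := hφ.parallel b _ hx
    simp [Fin.sum_univ_three, bracketTensor, he, ha, hb]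
  obtain ⟨x₀, hx₀⟩ := hc.nonempty
  set F := bilinTensor (leftInvariantForm σ) ![coordField φ a, coordField φ b] ∘ φ.symm with hF
  have h₃ : ∀ y ∈ φ.target, ∀ e, fderiv ℝ F (φ x₀) e =
      bracketTensor σ ![coordField φ e, coordField φ a, coordField φ b] (φ.symm y) := by
    intro y hy e
    obtain ⟨r, hr⟩ := h₂ e
    rw [h₁ _ (φ.map_source hx₀), hr _ (φ.map_source hx₀), hr _ hy]
  have hFd : ∀ y ∈ φ.target, DifferentiableAt ℝ F y := fun y hy =>
    (fderiv_comp_symm hA hy (hmd _ (φ.map_target hy))).1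
  -- The differential of `F` is the same at every point of the target, so subtracting its value at
  -- `φ x₀` as a linear map leaves a constant.
  obtain ⟨c, hcst⟩ := φ.open_target.exists_is_const_of_fderiv_eq_zero (𝕜 := ℝ)
    (f := fun y => F y - fderiv ℝ F (φ x₀) y) ht
    (fun y hy => ((hFd y hy).sub (fderiv ℝ F (φ x₀)).differentiableAt).differentiableWithinAt)
    (fun y hy => by
      rw [fderiv_fun_sub (hFd y hy) (fderiv ℝ F (φ x₀)).differentiableAt,
        ContinuousLinearMap.fderiv]
      ext e
      rw [sub_apply, h₁ y hy, h₃ y hy, sub_self]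
      rfl)
  refine ⟨fderiv ℝ F (φ x₀), c, fun x hx => ⟨?_, fun e => ?_⟩⟩
  · rw [← hcst _ (φ.map_source hx), hF, Function.comp_apply, φ.left_inv hx]
    exact (add_sub_cancel _ _).symm
  · rw [h₃ _ (φ.map_source hx), φ.left_inv hx]

end AffineCharts

/-! ### Affine functions as polynomials. -/

namespace MvPolynomial

variable {n : ℕ}

/-- The polynomial of degree at most one which defines an affine function. -/
noncomputable def ofAffine (L : EuclideanSpace ℝ (Fin n) →L[ℝ] ℝ) (c : ℝ) : MvPolynomial (Fin n) ℝ :=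
  C c + ∑ k, C (L (EuclideanSpace.single k 1)) * X k

theorem eval_ofAffine (L : EuclideanSpace ℝ (Fin n) →L[ℝ] ℝ) (c : ℝ) (x : EuclideanSpace ℝ (Fin n)) :
    eval (fun k => x k) (ofAffine L c) = L x + c := by
  have hx : x = ∑ k, x k • EuclideanSpace.single k (1 : ℝ) := by
    simpa using ((EuclideanSpace.basisFun (Fin n) ℝ).sum_repr x).symm
  conv_rhs => rw [hx]
  simp [ofAffine, add_comm, mul_comm]

theorem totalDegree_ofAffine_le (L : EuclideanSpace ℝ (Fin n) →L[ℝ] ℝ) (c : ℝ) :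
    (ofAffine L c).totalDegree ≤ 1 := by
  refine (totalDegree_add _ _).trans (max_le (by simp) (totalDegree_finsetSum_le fun k _ => ?_))
  exact (totalDegree_mul _ _).trans (by simp)

theorem eq_zero_of_totalDegree_ofAffine_eq_zero {L : EuclideanSpace ℝ (Fin n) →L[ℝ] ℝ} {c : ℝ}
    (h : (ofAffine L c).totalDegree = 0) : L = 0 := by
  have hC := totalDegree_eq_zero_iff_eq_C.1 h
  -- A polynomial of degree 0 is constant, so comparison with the value at 0 isolates `L`.
  have h₀ : ∀ x, L x + c = coeff 0 (ofAffine L c) := fun x => by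
    rw [← eval_ofAffine, hC]
    simp
  ext x
  have h₁ := (h₀ x).trans (h₀ 0).symm
  simpa using h₁

end MvPolynomial

/-! ### The main theorem. -/

theorem mainTheorem9 {n : ℕ} {G : Type*} [TopologicalSpace G]
    [ChartedSpace (EuclideanSpace ℝ (Fin n)) G] [Group G] [LieGroup (𝓡 n) ∞ G] [ConnectedSpace G]
    (σ : LinearMap.BilinForm ℝ (GroupLieAlgebra (𝓡 n) G))
    (hσ : IsSymplecticPoissonAlgebra σ)
    (hna : ¬ IsLieAbelian (GroupLieAlgebra (𝓡 n) G)) :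
    -- the third covariant derivative of the left-invariant form vanishes
    (∀ X : Fin (2 + 3) → Π g : G, TangentSpace (𝓡 n) g,
      (∀ i, ContMDiff (𝓡 n) (𝓡 n).tangent ∞
        (fun g => (⟨g, X i g⟩ : TangentBundle (𝓡 n) G))) →
      ∀ g : G, iteratedCovTensorDeriv (symplecticAffineConnection σ hσ.nondegenerate)
        (bilinTensor (leftInvariantForm σ)) 3 X g = 0) ∧
    -- the form is polynomial of degree one or two in every affine chart
    (∀ φ : OpenPartialHomeomorph G (EuclideanSpace ℝ (Fin n)),
      IsAffineChart (symplecticAffineConnection σ hσ.nondegenerate) φ →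
      IsConnected φ.source →
      ∃ d : ℕ, IsPolynomialOfDegreeIn (leftInvariantForm σ) φ d ∧ 1 ≤ d ∧ d ≤ 2 ∧
        ((∃ x ∈ (⁅(⊤ : LieIdeal ℝ (GroupLieAlgebra (𝓡 n) G)),
              (⊤ : LieIdeal ℝ (GroupLieAlgebra (𝓡 n) G))⁆ :
              LieIdeal ℝ (GroupLieAlgebra (𝓡 n) G)),
            ∃ y ∈ (⁅(⊤ : LieIdeal ℝ (GroupLieAlgebra (𝓡 n) G)),
              (⊤ : LieIdeal ℝ (GroupLieAlgebra (𝓡 n) G))⁆ :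
              LieIdeal ℝ (GroupLieAlgebra (𝓡 n) G)), σ x y ≠ 0) →
          d = 2)) := by
  have : IsManifold (𝓡 n) 2 G := IsManifold.of_le (n := ∞) (WithTop.coe_le_coe.2 (le_top : (2 : ℕ∞) ≤ ⊤))
  refine ⟨fun X hX g => congrFun (iteratedCovTensorDeriv_three_leftInvariantForm hσ hX) g,
    fun φ hφ hc => ?_⟩
  choose L c hL using exists_affine_leftInvariantForm hσ hφ hc
  let e (i : Fin n) : EuclideanSpace ℝ (Fin n) := EuclideanSpace.single i 1
  let P (i j : Fin n) : MvPolynomial (Fin n) ℝ := .ofAffine (L (e i) (e j)) (c (e i) (e j))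
  have hle : (Finset.univ.sup fun p : Fin n × Fin n => (P p.1 p.2).totalDegree) ≤ 1 :=
    Finset.sup_le fun p _ => MvPolynomial.totalDegree_ofAffine_le _ _
  have hpos : 1 ≤ Finset.univ.sup fun p : Fin n × Fin n => (P p.1 p.2).totalDegree := by
    by_contra! h
    obtain ⟨x, hx⟩ := hc.nonempty
    have hLe : ∀ i j, L (e i) (e j) = 0 := fun i j =>
      MvPolynomial.eq_zero_of_totalDegree_ofAffine_eq_zero (c := c (e i) (e j)) <|
        Nat.eq_zero_of_le_zero <| (Finset.le_sup (f := fun p : Fin n × Fin n =>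
          (P p.1 p.2).totalDegree) (Finset.mem_univ (i, j))).trans (Nat.lt_one_iff.1 h).le
    -- `A` reads the coordinate frame at `x` in the Lie algebra. It is onto, so brackets of the
    -- frame vectors decide whether the algebra is abelian.
    let A : EuclideanSpace ℝ (Fin n) →ₗ[ℝ] GroupLieAlgebra (𝓡 n) G :=
      (leftTrivialize (𝓡 n) x).toLinearMap ∘ₗ
        (mfderiv (𝓡 n) (𝓡 n) φ x).inverse.toLinearMap
    have hA : Function.Surjective A := fun v => by
      refine ⟨mfderiv (𝓡 n) (𝓡 n) φ x (leftTranslate (𝓡 n) x v), ?_⟩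
      have h' := coordField_mfderiv hφ.mem_maximalAtlas hx (leftTranslate (𝓡 n) x v)
      exact (congrArg (leftTrivialize (𝓡 n) x) h').trans (leftTrivialize_leftTranslate x v)
    have hbr : ∀ i j, ⁅A (e i), A (e j)⁆ = 0 := fun i j => by
      -- Pairing `u` with this bracket gives a component of T, that is, a value of the vanishing
      -- linear part.
      refine hσ.nondegenerate.2 _ fun u => ?_
      obtain ⟨a, rfl⟩ := hA u
      refine ((hL (e i) (e j) x hx).2 a).symm.trans ?_
      rw [hLe]
      rfl
    have hB : (lieBilinear (𝓡 n) G).compl₁₂ A A = 0 := by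
      refine LinearMap.ext_basis (EuclideanSpace.basisFun (Fin n) ℝ).toBasis
        (EuclideanSpace.basisFun (Fin n) ℝ).toBasis fun i j => ?_
      simp only [OrthonormalBasis.coe_toBasis, EuclideanSpace.basisFun_apply]
      exact hbr i j
    refine hna ⟨fun u v => ?_⟩
    obtain ⟨a, rfl⟩ := hA u
    obtain ⟨b, rfl⟩ := hA v
    exact LinearMap.congr_fun₂ hB a b
  refine ⟨_, ⟨P, fun i j x hx => ?_, rfl⟩, hpos, hle.trans one_le_two, ?_⟩
  · rw [MvPolynomial.eval_ofAffine]
    exact (hL (e i) (e j) x hx).1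
  -- The degree is 1 here; the implication holds because its premise contradicts isotropy.
  · rintro ⟨x, hx, y, hy, hxy⟩
    exact absurd (hσ.apply_eq_zero_of_mem_derived hx hy) hxy
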